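/- A subset $A$ of a group $G$ is called $k$-stable if there do not exist $a_1,\dots,a_k,b_1,\dots,b_k\in G$ such that, for all $1\le i,j\le k$, $a_ib_j\in A$ if and only if $i\le j$. **Theorem 1.6.** For every natural number $k$ there are constants $K_k\in\mathbb{R}$ and $N_k\in\mathbb{N}$, depending only on $k$, such that the following holds. Let $G$ be any group, let $A\subseteq G$ be a finite nonempty $k$-stable set, let $c$ be a real number with $|AA^{-1}A|\le c|A|$, and let $0<\epsilon\le\frac12$. Then there is a subgroup $H\le G$ with the following properties. (i) $H\subseteq A^{-1}A$, and $A\subseteq CH$ for some $C\subseteq A$ with $|C|\le K_k\,(c\,\epsilon^{-1})^{N_k}$. (ii) There is a set $D\subseteq C$, with $C$ as in (i), such that $|A\mathbin{\triangle} DH|<\epsilon|H|$. -/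

import Mathlib

open scoped Pointwise symmDiff

/-- A subset `A` of a group `G` is `k`-stable if there do not exist `a₁, …, a_k, b₁, …, b_k ∈ G`
such that `aᵢ bⱼ ∈ A` if and only if `i ≤ j`. -/
def IsKStable {G : Type*} [Group G] (k : ℕ) (A : Set G) : Prop :=
  ¬ ∃ a b : Fin k → G, ∀ i j : Fin k, a i * b j ∈ A ↔ i ≤ j

/-! Write d(g) = |Ag⁻¹ ∆ A| (`shiftDist`), a symmetric subadditive function on G. If d takes no
value in (r, s] and 2r ≤ s, then {g : d(g) ≤ s} is a subgroup H. Stability forces such a gap at one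
of boundedly many scales: elements with d(g) in the forbidden range at each of n widely separated
scales would generate a binary tree of height n for the relation xy ∈ A
(`exists_hasTree_of_scales`), whereas k-stability bounds the height of such trees in terms of k
(`IsKStable.exists_height_not_hasTree`).

H is large because stability also forbids shattered k-sets. A packing bound then limits the number
of well separated translates of A, so that few left translates of H cover A
(`IsKStable.card_le_mul_card_almost_invariant`). Since s ≤ |A| gives H ⊆ A⁻¹A, small tripling bounds
|AH| and hence the number of cosets. Finally, elements of H move A by at most r, so a majority vote
in each coset of H changes A in at most 4r points (`exists_coset_approximation`). The scales are
chosen recursively to make 4r < ε|H|; boundedly many steps keep all bounds polynomial in c/ε. -/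

section Trees

/-! ### Trees and ladders of a binary relation. -/

variable {X Y : Type*}

/-- `HasTree R n U V` says that there is a complete binary tree of height `n` whose inner nodes are
labelled by elements of `U`, whose leaves are labelled by elements of `V`, and such that a leaf `y`
below a node `x` is related to `x` exactly if it lies on the left of `x`. -/
def HasTree (R : X → Y → Prop) : ℕ → Set X → Set Y → Prop
  | 0, _, V => V.Nonempty
  | n + 1, U, V =>
      ∃ x ∈ U, HasTree R n U {y ∈ V | R x y} ∧ HasTree R n U {y ∈ V | ¬ R x y}

/-- `HasLadder R n U V` says that there are `x₁, …, xₙ ∈ U` and `y₁, …, yₙ ∈ V` such that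
`R xᵢ yⱼ` holds if and only if `j ≤ i`. -/
def HasLadder (R : X → Y → Prop) : ℕ → Set X → Set Y → Prop
  | 0, _, _ => True
  | n + 1, U, V =>
      ∃ x ∈ U, ∃ y ∈ V, R x y ∧ HasLadder R n {x' ∈ U | R x' y} {y' ∈ V | ¬ R x y'}

variable {R : X → Y → Prop}

theorem HasTree.mono {n : ℕ} {U U' : Set X} {V V' : Set Y} (h : HasTree R n U V)
    (hU : U ⊆ U') (hV : V ⊆ V') : HasTree R n U' V' := by
  induction n generalizing V V' with
  | zero => exact Set.Nonempty.mono hV h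
  | succ n ih =>
    obtain ⟨x, hx, h1, h2⟩ := h
    exact ⟨x, hU hx, ih h1 fun y hy => ⟨hV hy.1, hy.2⟩, ih h2 fun y hy => ⟨hV hy.1, hy.2⟩⟩

theorem HasTree.nonempty {n : ℕ} {U : Set X} {V : Set Y} (h : HasTree R n U V) : V.Nonempty := by
  induction n generalizing V with
  | zero => exact h
  | succ n ih =>
    obtain ⟨x, _, h1, _⟩ := h
    exact (ih h1).mono fun y hy => hy.1

theorem HasLadder.mono {n : ℕ} {U U' : Set X} {V V' : Set Y} (h : HasLadder R n U V)
    (hU : U ⊆ U') (hV : V ⊆ V') : HasLadder R n U' V' := by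
  induction n generalizing U U' V V' with
  | zero => trivial
  | succ n ih =>
    obtain ⟨x, hx, y, hy, hxy, h⟩ := h
    exact ⟨x, hU hx, y, hV hy, hxy,
      ih h (fun z hz => ⟨hU hz.1, hz.2⟩) (fun z hz => ⟨hV hz.1, hz.2⟩)⟩

/-- Suppose the root label lies in U₁. Either both subtrees yield U₁-trees of height p - 1, which
the root joins, or one of them already yields a U₂-tree of height q. The other case is symmetric. -/
theorem HasTree.union {p q : ℕ} {U₁ U₂ : Set X} {V : Set Y} (h : HasTree R (p + q) (U₁ ∪ U₂) V) :
    HasTree R p U₁ V ∨ HasTree R q U₂ V := by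
  obtain ⟨n, hn⟩ : ∃ n, n = p + q := ⟨_, rfl⟩
  induction n generalizing p q V with
  | zero =>
    obtain rfl : p = 0 := by omega
    exact Or.inl h.nonempty
  | succ n ih =>
    rcases p with _ | p
    · exact Or.inl h.nonempty
    rcases q with _ | q
    · exact Or.inr h.nonempty
    rw [← hn] at h
    obtain ⟨x, hx, h1, h2⟩ := h
    rcases hx with hx | hx
    · have e : n = p + (q + 1) := by omega
      rw [e] at h1 h2
      rcases ih h1 e with h1 | h1
      · rcases ih h2 e with h2 | h2
        · exact Or.inl ⟨x, hx, h1, h2⟩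
        · exact Or.inr (h2.mono subset_rfl fun y hy => hy.1)
      · exact Or.inr (h1.mono subset_rfl fun y hy => hy.1)
    · have e : n = (p + 1) + q := by omega
      rw [e] at h1 h2
      rcases ih h1 e with h1 | h1
      · exact Or.inl (h1.mono subset_rfl fun y hy => hy.1)
      · rcases ih h2 e with h2 | h2
        · exact Or.inl (h2.mono subset_rfl fun y hy => hy.1)
        · exact Or.inr ⟨x, hx, h1, h2⟩

/-- A tree of large height yields a long ladder for the relation or for its negation. -/
theorem exists_height_hasLadder (a b : ℕ) : ∃ n : ℕ, ∀ {X Y : Type*} {R : X → Y → Prop}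
    {U : Set X} {V : Set Y}, HasTree R n U V →
      HasLadder R a U V ∨ HasLadder (fun x y => ¬ R x y) b U V := by
  obtain ⟨m, hm⟩ : ∃ m, m = a + b := ⟨_, rfl⟩
  induction m generalizing a b with
  | zero =>
    obtain rfl : a = 0 := by omega
    exact ⟨0, fun _ => Or.inl trivial⟩
  | succ m ih =>
    rcases a with _ | a
    · exact ⟨0, fun _ => Or.inl trivial⟩
    rcases b with _ | b
    · exact ⟨0, fun _ => Or.inr trivial⟩
    obtain ⟨p, hp⟩ := ih a (b + 1) (by omega)
    obtain ⟨q, hq⟩ := ih (a + 1) b (by omega)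
    -- Colour the node labels by their relation to one leaf y. A monochromatic tree survives; its
    -- root and y form the first rung, and the ladder continues in the subtree whose leaves disagree
    -- with y about that root.
    refine ⟨(p + 1) + (q + 1), fun {X Y R U V} h => ?_⟩
    obtain ⟨y, hy⟩ := h.nonempty
    have hU : U = {x ∈ U | R x y} ∪ {x ∈ U | ¬ R x y} := by
      ext x
      simp only [Set.mem_union, Set.mem_ofPred_eq]
      tauto
    rw [hU] at h
    rcases h.union with ⟨x, hx, -, h⟩ | ⟨x, hx, h, -⟩
    · rcases hp h with h | h
      · exact Or.inl ⟨x, hx.1, y, hy, hx.2, h⟩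
      · exact Or.inr (h.mono (fun z hz => hz.1) fun z hz => hz.1)
    · rcases hq h with h | h
      · exact Or.inl (h.mono (fun z hz => hz.1) fun z hz => hz.1)
      · exact Or.inr ⟨x, hx.1, y, hy, hx.2,
          h.mono subset_rfl fun z hz => ⟨hz.1, not_not.2 hz.2⟩⟩

theorem HasLadder.exists_fin {n : ℕ} {U : Set X} {V : Set Y} (h : HasLadder R n U V) :
    ∃ (x : Fin n → X) (y : Fin n → Y), (∀ i, x i ∈ U) ∧ (∀ j, y j ∈ V) ∧
      ∀ i j, R (x i) (y j) ↔ j ≤ i := by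
  induction n generalizing U V with
  | zero => exact ⟨Fin.elim0, Fin.elim0, fun i => i.elim0, fun i => i.elim0, fun i => i.elim0⟩
  | succ n ih =>
    obtain ⟨x₀, hx₀, y₀, hy₀, hxy, h⟩ := h
    obtain ⟨x, y, hx, hy, h⟩ := ih h
    refine ⟨Fin.cons x₀ x, Fin.cons y₀ y, ?_, ?_, ?_⟩
    · exact fun i => Fin.cases hx₀ (fun i => (hx i).1) i
    · exact fun i => Fin.cases hy₀ (fun i => (hy i).1) i
    · intro i j
      induction i using Fin.cases with
      | zero =>
        induction j using Fin.cases with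
        | zero => simpa using hxy
        | succ j => simpa using (hy j).2
      | succ i =>
        induction j using Fin.cases with
        | zero => simpa using (hx i).2
        | succ j => simpa using h i j

end Trees

/-- The relation `x * y ∈ A` attached to a `k`-stable set admits trees of bounded height only. -/
theorem IsKStable.exists_height_not_hasTree (k : ℕ) : ∃ n : ℕ, ∀ {G : Type*} [Group G] {A : Set G},
    IsKStable k A → ∀ V : Set G, ¬ HasTree (fun x y : G => x * y ∈ A) n Set.univ V := by
  -- A ladder for R only needs reversing. One for the negation reads xᵢyⱼ ∈ A iff i < j; the extra
  -- rung allows the shift of j that turns this into i ≤ j.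
  obtain ⟨n, hn⟩ := exists_height_hasLadder k (k + 1)
  refine ⟨n, fun {G _ A} hA V h => hA ?_⟩
  rcases hn h with h | h
  · obtain ⟨x, y, -, -, h⟩ := h.exists_fin
    refine ⟨fun i => x i.rev, fun j => y j.rev, fun i j => ?_⟩
    rw [h, Fin.rev_le_rev]
  · obtain ⟨x, y, -, -, h⟩ := h.exists_fin
    refine ⟨fun i => x i.castSucc, fun j => y j.succ, fun i j => ?_⟩
    have := h i.castSucc j.succ
    rw [← not_iff_not, this, not_le, Fin.succ_le_castSucc_iff]

/-! ### How far right translation moves a finite set. -/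

section ShiftDist

variable {G : Type*} [Group G]

/-- The set of all `x` with `x * g ∈ A`. -/
def rightShift (A : Finset G) (g : G) : Finset G := A.map (Equiv.mulRight g⁻¹).toEmbedding

@[simp]
theorem mem_rightShift {A : Finset G} {g x : G} : x ∈ rightShift A g ↔ x * g ∈ A := by
  simp only [rightShift, Finset.mem_map_equiv]
  simp

@[simp]
theorem card_rightShift (A : Finset G) (g : G) : (rightShift A g).card = A.card :=
  Finset.card_map _

variable [DecidableEq G]

/-- The number of points at which `A` and its right translate by `g` differ. -/
def shiftDist (A : Finset G) (g : G) : ℕ := (rightShift A g ∆ A).card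

theorem shiftDist_one (A : Finset G) : shiftDist A 1 = 0 := by
  have : rightShift A 1 = A := by ext; simp
  simp [shiftDist, this]

/-- Right translation preserves cardinality, so the distance between two shifts depends only on
g⁻¹h. Symmetry and subadditivity of `shiftDist` come from this. -/
theorem card_rightShift_symmDiff (A : Finset G) (g h : G) :
    (rightShift A g ∆ rightShift A h).card = shiftDist A (g⁻¹ * h) := by
  rw [shiftDist, ← card_rightShift (rightShift A (g⁻¹ * h) ∆ A) g]
  congr 1
  ext x
  simp only [Finset.mem_symmDiff, mem_rightShift, mul_assoc, mul_inv_cancel_left]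
  tauto

theorem shiftDist_inv (A : Finset G) (g : G) : shiftDist A g⁻¹ = shiftDist A g := by
  have h := card_rightShift_symmDiff A g 1
  have e : rightShift A 1 = A := by ext; simp
  rw [mul_one, e] at h
  exact h.symm

theorem shiftDist_mul_le (A : Finset G) (g h : G) :
    shiftDist A (g * h) ≤ shiftDist A g + shiftDist A h := by
  have e := card_rightShift_symmDiff A g (g * h)
  rw [inv_mul_cancel_left] at e
  rw [← e, shiftDist, shiftDist, ← Finset.card_union_add_card_inter]
  refine le_trans (Finset.card_le_card fun x hx => ?_) (Nat.le_add_right _ _)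
  simp only [Finset.mem_union, Finset.mem_symmDiff] at hx ⊢
  tauto

theorem two_mul_card_rightShift_sdiff (A : Finset G) (g : G) :
    2 * (rightShift A g \ A).card = shiftDist A g := by
  have h1 : (rightShift A g \ A).card = (A \ rightShift A g).card :=
    Finset.card_sdiff_comm (card_rightShift A g)
  have h2 : shiftDist A g = (rightShift A g \ A).card + (A \ rightShift A g).card := by
    have hd : Disjoint (rightShift A g \ A) (A \ rightShift A g) := disjoint_sdiff_sdiff
    rw [← Finset.card_union_of_disjoint hd]
    rfl
  omega

theorem card_sdiff_rightShift_le (A : Finset G) (g : G) :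
    (A \ rightShift A g).card ≤ shiftDist A g :=
  Finset.card_le_card fun x hx => by
    simp only [Finset.mem_sdiff, Finset.mem_symmDiff] at hx ⊢
    tauto

/-- A shift disjoint from A would differ from it in 2|A| points, so there is x with both x and xg in
A. -/
theorem mem_inv_mul_of_shiftDist_le {A : Finset G} {g : G} (hA : A.Nonempty)
    (hg : shiftDist A g ≤ A.card) : g ∈ A⁻¹ * A := by
  have h1 := two_mul_card_rightShift_sdiff A g
  have hpos := hA.card_pos
  have h2 : ∃ x ∈ rightShift A g, x ∈ A := by
    by_contra! h
    have : rightShift A g \ A = rightShift A g := Finset.sdiff_eq_self_of_disjoint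
      (Finset.disjoint_left.2 h)
    rw [this, card_rightShift] at h1
    omega
  obtain ⟨x, hx, hxA⟩ := h2
  rw [mem_rightShift] at hx
  exact Finset.mem_mul.2 ⟨x⁻¹, Finset.inv_mem_inv hxA, x * g, hx, by group⟩

/-- Elements that move `A` at many widely separated scales generate a tree. -/
theorem exists_hasTree_of_scales (A : Finset G) (s r : ℕ → ℝ) (g : ℕ → G) (N : ℕ)
    (hs : ∀ m, 0 ≤ s m) (hsr : ∀ m, 8 * s (m + 1) ≤ r m)
    (hg : ∀ m < N, (shiftDist A (g m) : ℝ) ≤ s m ∧ r m < shiftDist A (g m)) (n m : ℕ)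
    (hmn : m + n ≤ N) :
    ∃ (P : Set G) (U : Finset G), (U.card : ℝ) ≤ 2 * s m ∧
      (∀ y ∈ P, ∀ x ∉ U, x * y ∈ A ↔ x ∈ A) ∧
      ∀ z : G, HasTree (fun x y : G => x * y ∈ A) n Set.univ ((z * ·) '' P) := by
  induction n generalizing m with
  | zero =>
    refine ⟨{1}, ∅, by simpa using hs m, by simp, fun z => ?_⟩
    exact ⟨z, by simp⟩
  | succ n ih =>
    obtain ⟨P, U, hU, hPU, hP⟩ := ih (m + 1) (by omega)
    obtain ⟨hgs, hgr⟩ := hg m (by omega)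
    have hdiff := two_mul_card_rightShift_sdiff A (g m)
    -- More than `r m / 2` points enter A under g, while the exceptional sets have at most `4 * s (m
    -- + 1) ≤ r m / 2` points in total. Such an x outside them separates gP from P.
    obtain ⟨x, hx, hxU⟩ : ∃ x ∈ rightShift A (g m) \ A, x ∉ U ∪ rightShift U (g m) := by
      by_contra! h
      have h1 : (rightShift A (g m) \ A).card ≤ U.card + U.card := by
        calc _ ≤ (U ∪ rightShift U (g m)).card := Finset.card_le_card h
          _ ≤ U.card + (rightShift U (g m)).card := Finset.card_union_le _ _
          _ = _ := by rw [card_rightShift]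
      have h2 : (shiftDist A (g m) : ℝ) ≤ 4 * U.card := by
        exact_mod_cast (by omega : shiftDist A (g m) ≤ 4 * U.card)
      linarith [hsr m]
    simp only [Finset.mem_sdiff, mem_rightShift, Finset.mem_union, not_or] at hx hxU
    refine ⟨P ∪ (g m * ·) '' P, U ∪ rightShift U (g m) ∪ (rightShift A (g m) ∆ A), ?_, ?_, ?_⟩
    · have h1 : (U ∪ rightShift U (g m) ∪ (rightShift A (g m) ∆ A)).card ≤
          U.card + U.card + shiftDist A (g m) := by
        calc _ ≤ (U ∪ rightShift U (g m)).card + shiftDist A (g m) := Finset.card_union_le _ _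
          _ ≤ U.card + (rightShift U (g m)).card + shiftDist A (g m) := by
            gcongr; exact Finset.card_union_le _ _
          _ = _ := by rw [card_rightShift]
      have h2 : ((U ∪ rightShift U (g m) ∪ (rightShift A (g m) ∆ A)).card : ℝ) ≤
          U.card + U.card + shiftDist A (g m) := by exact_mod_cast h1
      linarith [hsr m, hs m]
    · rintro y (hy | ⟨y, hy, rfl⟩) x hx
      · simp only [Finset.mem_union, not_or] at hx
        exact hPU y hy x hx.1.1
      · simp only [Finset.mem_union, not_or, mem_rightShift, Finset.mem_symmDiff] at hx
        have := hPU y hy (x * g m) hx.1.2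
        rw [mul_assoc] at this
        rw [this]
        tauto
    · intro z
      -- The factor z⁻¹ undoes the translation of the leaves; having trees on all translates of P
      -- supplies both subtrees, on zgP and on zP.
      refine ⟨x * z⁻¹, trivial, (hP (z * g m)).mono subset_rfl ?_, (hP z).mono subset_rfl ?_⟩
      · rintro _ ⟨y, hy, rfl⟩
        refine ⟨⟨g m * y, Or.inr ⟨y, hy, rfl⟩, by simp [mul_assoc]⟩, ?_⟩
        have := (hPU y hy (x * g m) hxU.2).2 hx.1
        simpa [mul_assoc] using this
      · rintro _ ⟨y, hy, rfl⟩
        refine ⟨⟨y, Or.inl hy, rfl⟩, ?_⟩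
        have := mt (hPU y hy x hxU.1).1 hx.2
        simpa [mul_assoc] using this

/-- The elements that move `A` by at most `s` form a subgroup if none of them moves `A` by more
than `s / 2`. -/
def shiftStabilizer (A : Finset G) (s r : ℝ) (hr : 0 ≤ r) (hrs : 2 * r ≤ s)
    (h : ∀ g, (shiftDist A g : ℝ) ≤ s → (shiftDist A g : ℝ) ≤ r) : Subgroup G where
  carrier := {g | (shiftDist A g : ℝ) ≤ s}
  one_mem' := by
    simp only [Set.mem_ofPred_eq, shiftDist_one, Nat.cast_zero]
    linarith
  inv_mem' := fun {g} hg => by simpa only [Set.mem_ofPred_eq, shiftDist_inv] using hg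
  mul_mem' := fun {a b} ha hb => by
    have h1 : (shiftDist A (a * b) : ℝ) ≤ shiftDist A a + shiftDist A b := by
      exact_mod_cast shiftDist_mul_le A a b
    have h2 := h a ha
    have h3 := h b hb
    simp only [Set.mem_ofPred_eq]
    linarith

end ShiftDist

/-! ### A packing bound for set families without large shattered sets. -/

section Packing

variable {α : Type*} [DecidableEq α]

/-- A few points suffice to separate all but a small proportion of a set of pairs of subsets of `X`,
each of which differs on a positive proportion of `X`. -/
theorem exists_finset_card_not_separated_le {X : Finset α} (hX : X.Nonempty)
    (P : Finset (Finset α × Finset α)) {η : ℝ} (hη : η ≤ 1)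
    (hP : ∀ p ∈ P, p.1 ∆ p.2 ⊆ X ∧ η * X.card ≤ ((p.1 ∆ p.2).card : ℝ)) (m : ℕ) :
    ∃ S : Finset α, S.card ≤ m ∧
      ((P.filter fun p => Disjoint (p.1 ∆ p.2) S).card : ℝ) ≤ (1 - η) ^ m * P.card := by
  induction m with
  | zero => exact ⟨∅, by simp, by simp⟩
  | succ m ih =>
    obtain ⟨S, hS, hPS⟩ := ih
    set Q := P.filter fun p => Disjoint (p.1 ∆ p.2) S with hQ
    have hcount : ∑ x ∈ X, (Q.filter fun p => x ∈ p.1 ∆ p.2).card =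
        ∑ p ∈ Q, (p.1 ∆ p.2).card := by
      have h := Finset.sum_card_bipartiteAbove_eq_sum_card_bipartiteBelow
        (s := X) (t := Q) (fun x p => x ∈ p.1 ∆ p.2)
      simp only [Finset.bipartiteAbove, Finset.bipartiteBelow] at h
      rw [h]
      refine Finset.sum_congr rfl fun p hp => ?_
      rw [Finset.filter_mem_eq_inter,
        Finset.inter_eq_right.2 (hP p (Finset.mem_filter.1 hp).1).1]
    -- By averaging over X, some point separates a proportion η of the remaining pairs.
    obtain ⟨x, -, hx⟩ : ∃ x ∈ X, η * Q.card ≤ ((Q.filter fun p => x ∈ p.1 ∆ p.2).card : ℝ) := by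
      refine Finset.exists_le_of_sum_le hX ?_
      rw [← Nat.cast_sum, hcount, Finset.sum_const, nsmul_eq_mul, Nat.cast_sum]
      calc (X.card : ℝ) * (η * Q.card) = ∑ p ∈ Q, η * X.card := by
            rw [Finset.sum_const, nsmul_eq_mul]; ring
        _ ≤ _ := Finset.sum_le_sum fun p hp => (hP p (Finset.mem_filter.1 hp).1).2
    refine ⟨insert x S, (Finset.card_insert_le _ _).trans (by omega), ?_⟩
    have e : (P.filter fun p => Disjoint (p.1 ∆ p.2) (insert x S)) =
        Q.filter fun p => ¬ x ∈ p.1 ∆ p.2 := by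
      rw [hQ, Finset.filter_filter]
      refine Finset.filter_congr fun p _ => ?_
      rw [Finset.disjoint_insert_right]
      tauto
    have h2 : ((Q.filter fun p => x ∈ p.1 ∆ p.2).card : ℝ) +
        (Q.filter fun p => ¬ x ∈ p.1 ∆ p.2).card = Q.card := by
      exact_mod_cast Finset.card_filter_add_card_filter_not (s := Q) (fun p => x ∈ p.1 ∆ p.2)
    rw [e]
    calc _ ≤ (1 - η) * Q.card := by linarith
      _ ≤ (1 - η) * ((1 - η) ^ m * P.card) := by
        apply mul_le_mul_of_nonneg_left hPS; linarith
      _ = _ := by ring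

/-- A polynomial form of the Sauer–Shelah lemma. -/
theorem card_le_of_forall_not_shatters {𝒬 : Finset (Finset α)} {S : Finset α} {k : ℕ}
    (hS : ∀ F ∈ 𝒬, F ⊆ S) (hk : ∀ T : Finset α, T.card = k → ¬ 𝒬.Shatters T) :
    𝒬.card ≤ k * (S.card + 1) ^ k := by
  refine 𝒬.card_le_card_shatterer.trans ?_
  -- Shattering passes to subsets, so every shattered set has fewer than k elements.
  have hsub : 𝒬.shatterer ⊆ (Finset.range k).biUnion fun i => S.powersetCard i := by
    intro T hT
    rw [Finset.mem_shatterer] at hT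
    obtain ⟨F, hF, hTF⟩ := hT.exists_superset
    simp only [Finset.mem_biUnion, Finset.mem_range, Finset.mem_powersetCard]
    refine ⟨T.card, ?_, hTF.trans (hS F hF), rfl⟩
    by_contra! h
    obtain ⟨T', hT', hc⟩ := Finset.exists_subset_card_eq h
    exact hk T' hc (hT.mono_right hT')
  calc 𝒬.shatterer.card ≤ _ := Finset.card_le_card hsub
    _ ≤ ∑ i ∈ Finset.range k, (S.powersetCard i).card := Finset.card_biUnion_le
    _ ≤ ∑ _i ∈ Finset.range k, (S.card + 1) ^ k := by
      refine Finset.sum_le_sum fun i hi => ?_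
      rw [Finset.card_powersetCard]
      calc S.card.choose i ≤ S.card ^ i := Nat.choose_le_pow _ _
        _ ≤ (S.card + 1) ^ i := Nat.pow_le_pow_left (Nat.le_succ _) _
        _ ≤ (S.card + 1) ^ k := Nat.pow_le_pow_right (Nat.succ_pos _) (Finset.mem_range.1 hi).le
    _ = _ := by simp

/-- About 2 log M / η points separate all pairs among the M = |𝒬| sets. The traces on these points
are then distinct, and Sauer–Shelah bounds M by a power of log M / η. -/
theorem card_le_of_separated {X : Finset α} (hX : X.Nonempty) {𝒬 : Finset (Finset α)} {k : ℕ}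
    (hk0 : k ≠ 0) {η : ℝ} (hη0 : 0 < η) (hη : η ≤ 1) (hQX : ∀ F ∈ 𝒬, F ⊆ X)
    (hsep : ∀ F ∈ 𝒬, ∀ F' ∈ 𝒬, F ≠ F' → η * X.card ≤ ((F ∆ F').card : ℝ))
    (hk : ∀ T : Finset α, T.card = k → ¬ 𝒬.Shatters T) :
    (𝒬.card : ℝ) ≤ (k * (4 * k / η) ^ k) ^ 2 := by
  rcases 𝒬.eq_empty_or_nonempty with rfl | hQ
  · simp only [Finset.card_empty, Nat.cast_zero]; positivity
  obtain ⟨M, hM⟩ : ∃ M : ℝ, M = 𝒬.card := ⟨_, rfl⟩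
  rw [← hM]
  have hM1 : 1 ≤ M := by rw [hM]; exact_mod_cast hQ.card_pos
  have hlog : 0 ≤ Real.log M := Real.log_nonneg hM1
  -- With this m fewer than one of the at most M² pairs remains unseparated.
  set m := ⌊2 * Real.log M / η⌋₊ + 1 with hm
  have hmlt : 2 * Real.log M / η < m := by rw [hm]; push_cast; exact Nat.lt_floor_add_one _
  have hmle : (m : ℝ) ≤ 2 * Real.log M / η + 1 := by
    rw [hm]; push_cast
    linarith [Nat.floor_le (show 0 ≤ 2 * Real.log M / η by positivity)]
  obtain ⟨S, hSm, hS⟩ := exists_finset_card_not_separated_le hX 𝒬.offDiag hη (fun p hp => by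
    obtain ⟨h1, h2, h3⟩ := Finset.mem_offDiag.1 hp
    refine ⟨?_, hsep _ h1 _ h2 h3⟩
    exact symmDiff_le_sup.trans (Finset.union_subset (hQX _ h1) (hQX _ h2))) m
  have hpow : (1 - η) ^ m * M ^ 2 < 1 := by
    have h1 : (1 - η) ^ m ≤ Real.exp (-(η * m)) := by
      calc (1 - η) ^ m ≤ (Real.exp (-η)) ^ m :=
            pow_le_pow_left₀ (by linarith) (Real.one_sub_le_exp_neg η) m
        _ = _ := by rw [← Real.exp_nat_mul]; ring_nf
    have h2 : M ^ 2 = Real.exp (2 * Real.log M) := by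
      rw [two_mul, Real.exp_add, Real.exp_log (by linarith)]; ring
    rw [div_lt_iff₀ hη0] at hmlt
    calc (1 - η) ^ m * M ^ 2 ≤ Real.exp (-(η * m)) * M ^ 2 := by gcongr
      _ = Real.exp (2 * Real.log M - η * m) := by rw [h2, ← Real.exp_add]; ring_nf
      _ < 1 := by rw [Real.exp_lt_one_iff]; linarith
  have hoff : (𝒬.offDiag.card : ℝ) ≤ M ^ 2 := by
    rw [hM, sq]
    exact_mod_cast (Finset.offDiag_card 𝒬).le.trans (Nat.sub_le _ _)
  have hempty : (𝒬.offDiag.filter fun p => Disjoint (p.1 ∆ p.2) S) = ∅ := by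
    rw [← Finset.card_eq_zero, ← Nat.lt_one_iff]
    have : ((𝒬.offDiag.filter fun p => Disjoint (p.1 ∆ p.2) S).card : ℝ) < 1 := by
      refine (hS.trans ?_).trans_lt hpow
      apply mul_le_mul_of_nonneg_left hoff
      exact pow_nonneg (by linarith) _
    exact_mod_cast this
  have hinj : Set.InjOn (fun F => F ∩ S) (𝒬 : Set (Finset α)) := by
    intro F hF F' hF' hFF'
    by_contra hne
    have : (F, F') ∈ 𝒬.offDiag.filter fun p => Disjoint (p.1 ∆ p.2) S := by
      refine Finset.mem_filter.2 ⟨Finset.mem_offDiag.2 ⟨hF, hF', hne⟩, ?_⟩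
      refine Finset.disjoint_left.2 fun x hx hxS => ?_
      have h := Finset.ext_iff.1 hFF' x
      simp only [Finset.mem_inter, hxS, and_true] at h
      simp only [Finset.mem_symmDiff] at hx
      tauto
    rw [hempty] at this
    exact absurd this (Finset.notMem_empty _)
  have hcard : 𝒬.card ≤ k * (S.card + 1) ^ k := by
    rw [← Finset.card_image_of_injOn hinj]
    refine card_le_of_forall_not_shatters (fun F hF => ?_) (fun T hT hTs => hk T hT ?_)
    · obtain ⟨F, -, rfl⟩ := Finset.mem_image.1 hF
      exact Finset.inter_subset_right
    · obtain ⟨F, hF, hTF⟩ := hTs.exists_superset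
      obtain ⟨F, -, rfl⟩ := Finset.mem_image.1 hF
      have hTS : T ⊆ S := hTF.trans Finset.inter_subset_right
      intro t ht
      obtain ⟨u, hu, rfl⟩ := hTs ht
      obtain ⟨F, hF, rfl⟩ := Finset.mem_image.1 hu
      refine ⟨F, hF, ?_⟩
      ext x
      have := @hTS x
      simp only [Finset.mem_inter]
      tauto
  have hk1 : (1 : ℝ) ≤ k := by exact_mod_cast Nat.one_le_iff_ne_zero.2 hk0
  -- Since M = y^(2k), log M is at most linear in y; the trace bound then grows only like y^k, and
  -- one factor y^k cancels.
  set y : ℝ := M ^ ((1 : ℝ) / (2 * k)) with hy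
  have hy0 : 0 < y := Real.rpow_pos_of_pos (by linarith) _
  have hyM : (y ^ k) ^ 2 = M := by
    rw [hy, ← Real.rpow_natCast, ← Real.rpow_natCast, ← Real.rpow_mul (by linarith),
      ← Real.rpow_mul (by linarith)]
    have : (1 : ℝ) / (2 * k) * (k * (2 : ℕ)) = 1 := by push_cast; field_simp
    rw [this, Real.rpow_one]
  have hlogy : Real.log M ≤ 2 * k * (y - 1) := by
    have h1 : Real.log M = 2 * k * Real.log y := by
      rw [← hyM, ← pow_mul, Real.log_pow]; push_cast; ring
    rw [h1]
    gcongr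
    exact Real.log_le_sub_one_of_pos hy0
  have hm1 : (S.card : ℝ) + 1 ≤ 4 * k / η * y := by
    have h1 : (S.card : ℝ) ≤ m := by exact_mod_cast hSm
    have h2 : (2 : ℝ) ≤ 2 / η := by rw [le_div_iff₀ hη0]; linarith
    have h3 : 2 * Real.log M / η ≤ (4 * k * y - 2) / η := by
      gcongr; nlinarith
    have h4 : (4 * k * y - 2) / η = 4 * k / η * y - 2 / η := by ring
    linarith
  have hMle : M ≤ k * (4 * k / η * y) ^ k := by
    calc M ≤ k * ((S.card : ℝ) + 1) ^ k := by rw [hM]; exact_mod_cast hcard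
      _ ≤ _ := by gcongr
  have hyk : y ^ k ≤ k * (4 * k / η) ^ k := by
    rw [← hyM, mul_pow, ← mul_assoc, sq] at hMle
    exact le_of_mul_le_mul_right hMle (by positivity)
  rw [← hyM]
  gcongr

end Packing

/-! ### Many almost-periods of a stable set. -/

section Group

variable {G : Type*} [Group G] [DecidableEq G]

/-- A stable set of small tripling is almost invariant under many right translations. -/
theorem IsKStable.card_le_mul_card_almost_invariant {k : ℕ} {A : Finset G}
    (hA : IsKStable k (A : Set G)) (hne : A.Nonempty) {c δ : ℝ}
    (hc : ((A * A⁻¹ * A).card : ℝ) ≤ c * A.card) (hδ0 : 0 < δ) (hδ1 : δ ≤ 1) :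
    (A.card : ℝ) ≤ (k * (4 * k * (c / δ)) ^ k) ^ 2 *
      ((A⁻¹ * A).filter fun g => (shiftDist A g : ℝ) ≤ δ * A.card).card := by
  have hk0 : k ≠ 0 := by
    rintro rfl
    exact hA ⟨Fin.elim0, Fin.elim0, fun i => i.elim0⟩
  have hApos : (0 : ℝ) < A.card := by exact_mod_cast hne.card_pos
  obtain ⟨a₀, ha₀⟩ := hne
  have hX : ((A * A⁻¹).card : ℝ) ≤ c * A.card := by
    refine le_trans ?_ hc
    exact_mod_cast Finset.card_le_card_mul_right ⟨a₀, ha₀⟩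
  have hAX : (A.card : ℝ) ≤ (A * A⁻¹).card := by
    exact_mod_cast Finset.card_le_card_mul_right ⟨a₀⁻¹, Finset.inv_mem_inv ha₀⟩
  have hc1 : 1 ≤ c := by nlinarith
  -- By maximality, a maximal separated subset of A is also a net: every shift by a point of A is
  -- close to one by a point of Q.
  obtain ⟨Q, hQ⟩ := (A.powerset.filter fun Q => ∀ a ∈ Q, ∀ b ∈ Q, a ≠ b →
    δ * A.card < ((rightShift A a ∆ rightShift A b).card : ℝ)).exists_maximal ⟨∅, by simp⟩
  obtain ⟨hQA, hQsep⟩ := Finset.mem_filter.1 hQ.prop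
  rw [Finset.mem_powerset] at hQA
  have hcover : ∀ a ∈ A, ∃ q ∈ Q, ((rightShift A q ∆ rightShift A a).card : ℝ) ≤ δ * A.card := by
    intro a ha
    by_cases haQ : a ∈ Q
    · exact ⟨a, haQ, by simp only [symmDiff_self, Finset.bot_eq_empty, Finset.card_empty,
        Nat.cast_zero]; positivity⟩
    by_contra! h
    have hmem : insert a Q ∈ A.powerset.filter fun Q => ∀ a ∈ Q, ∀ b ∈ Q, a ≠ b →
        δ * A.card < ((rightShift A a ∆ rightShift A b).card : ℝ) := by
      refine Finset.mem_filter.2 ⟨Finset.mem_powerset.2 (Finset.insert_subset ha hQA), ?_⟩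
      intro u hu v hv huv
      rw [Finset.mem_insert] at hu hv
      rcases hu with rfl | hu <;> rcases hv with rfl | hv
      · exact absurd rfl huv
      · rw [symmDiff_comm]; exact h v hv
      · exact h u hu
      · exact hQsep u hu v hv huv
    exact haQ (hQ.le_of_ge hmem (Finset.subset_insert a Q) (Finset.mem_insert_self a Q))
  have hinj : Set.InjOn (rightShift A) (Q : Set G) := by
    intro a ha b hb hab
    by_contra hne
    have h := hQsep a ha b hb hne
    simp only [hab, symmDiff_self, Finset.bot_eq_empty, Finset.card_empty, Nat.cast_zero] at h
    nlinarith
  have hQcard : (Q.card : ℝ) ≤ (k * (4 * k * (c / δ)) ^ k) ^ 2 := by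
    rw [← Finset.card_image_of_injOn hinj]
    -- Shifts by points of A lie in AA⁻¹, of size at most c|A|, so distance δ|A| is at least a
    -- proportion δ/c of it.
    have e : 4 * k * (c / δ) = 4 * k / (δ / c) := by field_simp
    rw [e]
    refine card_le_of_separated (X := A * A⁻¹) ⟨_, Finset.mul_mem_mul ha₀ (Finset.inv_mem_inv ha₀)⟩
      hk0 (by positivity) (by rw [div_le_one (by linarith)]; linarith) ?_ ?_ ?_
    · intro F hF x hx
      obtain ⟨a, ha, rfl⟩ := Finset.mem_image.1 hF
      rw [mem_rightShift] at hx
      exact Finset.mem_mul.2 ⟨_, hx, a⁻¹, Finset.inv_mem_inv (hQA ha), by group⟩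
    · intro F hF F' hF' hne
      obtain ⟨a, ha, rfl⟩ := Finset.mem_image.1 hF
      obtain ⟨b, hb, rfl⟩ := Finset.mem_image.1 hF'
      refine le_trans ?_ (hQsep a ha b hb fun h => hne (by rw [h])).le
      rw [div_mul_eq_mul_div, div_le_iff₀ (by linarith)]
      nlinarith
    -- Cutting out the initial segments of a shattered k-set by shifts produces exactly the
    -- configuration excluded by stability.
    · intro T hT hTs
      let x := (Finset.equivFinOfCardEq hT).symm
      have : ∀ j : Fin k, ∃ b : G, ∀ i : Fin k, (x i : G) * b ∈ A ↔ i ≤ j := by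
        intro j
        have hsub : (Finset.univ.filter (· ≤ j)).image (fun i => (x i : G)) ⊆ T := by
          intro z hz
          obtain ⟨i, -, rfl⟩ := Finset.mem_image.1 hz
          exact (x i).2
        obtain ⟨F, hF, hTF⟩ := hTs hsub
        obtain ⟨b, -, rfl⟩ := Finset.mem_image.1 hF
        refine ⟨b, fun i => ?_⟩
        have h := Finset.ext_iff.1 hTF (x i)
        simp only [Finset.mem_inter, mem_rightShift, Finset.mem_image, Finset.mem_filter,
          Finset.mem_univ, true_and, Subtype.coe_injective.eq_iff, x.injective.eq_iff,
          exists_eq_right, (x i).2] at h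
        exact h
      choose b hb using this
      exact hA ⟨fun i => x i, b, fun i j => hb j i⟩
  set Sδ := (A⁻¹ * A).filter fun g => (shiftDist A g : ℝ) ≤ δ * A.card with hSδ
  have hA_le : A.card ≤ Q.card * Sδ.card := by
    calc A.card ≤ (Q * Sδ).card := by
          refine Finset.card_le_card fun a ha => ?_
          obtain ⟨q, hq, hqa⟩ := hcover a ha
          rw [card_rightShift_symmDiff] at hqa
          refine Finset.mem_mul.2 ⟨q, hq, q⁻¹ * a, Finset.mem_filter.2 ⟨?_, hqa⟩, by group⟩
          exact Finset.mul_mem_mul (Finset.inv_mem_inv (hQA hq)) ha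
      _ ≤ _ := Finset.card_mul_le
  calc (A.card : ℝ) ≤ Q.card * Sδ.card := by exact_mod_cast hA_le
    _ ≤ _ := by gcongr

end Group

/-! ### Approximation by unions of cosets. -/

section Cosets

variable {G : Type*} [Group G] [DecidableEq G]

/-- The number of `h ∈ S` with `y * h ∈ A` depends only on the left coset of `y` if `S` is a
subgroup. -/
theorem card_filter_mul_mem_of_subgroup (A S : Finset G) (H : Subgroup G) (hS : (S : Set G) = H)
    (y : G) {g : G} (hg : g ∈ H) :
    (S.filter fun h => y * g * h ∈ A).card = (S.filter fun h => y * h ∈ A).card := by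
  have hmem : ∀ h, h ∈ S ↔ h ∈ H := fun h => by
    rw [← Finset.mem_coe, hS, SetLike.mem_coe]
  refine Finset.card_nbij' (g * ·) (g⁻¹ * ·) ?_ ?_ ?_ ?_
  · intro h hh
    simp only [Finset.coe_filter, Set.mem_ofPred_eq, hmem] at hh ⊢
    exact ⟨H.mul_mem hg hh.1, by rw [← mul_assoc]; exact hh.2⟩
  · intro h hh
    simp only [Finset.coe_filter, Set.mem_ofPred_eq, hmem] at hh ⊢
    exact ⟨H.mul_mem (H.inv_mem hg) hh.1, by simpa [mul_assoc] using hh.2⟩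
  · intro h _; simp
  · intro h _; simp

/-- A set that is almost invariant under right translation by the elements of a finite set `S` is
close to the set of all `y` such that `y * h ∈ A` for most `h ∈ S`. -/
theorem card_symmDiff_le_of_almost_invariant {A S E : Finset G} {r : ℝ} (hS : S.Nonempty)
    (hr : ∀ h ∈ S, (shiftDist A h : ℝ) ≤ r)
    (hE : ∀ y, y ∈ E ↔ S.card < 2 * (S.filter fun h => y * h ∈ A).card) :
    ((A ∆ E).card : ℝ) ≤ 4 * r := by
  have hsum : ((∑ h ∈ S, shiftDist A h : ℕ) : ℝ) ≤ S.card * r := by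
    push_cast
    calc _ ≤ ∑ _h ∈ S, r := Finset.sum_le_sum hr
      _ = _ := by rw [Finset.sum_const, nsmul_eq_mul]
  have hSpos : (0 : ℝ) < S.card := by exact_mod_cast hS.card_pos
  -- Each point y of A \ E or E \ A is outvoted: for at least half of the h ∈ S, y and yh are on
  -- different sides of A. Such pairs are counted by h instead.
  have h1 : (A \ E).card * S.card ≤ 2 * ∑ h ∈ S, shiftDist A h := by
    calc (A \ E).card * S.card = ∑ _y ∈ A \ E, S.card := by simp
      _ ≤ ∑ y ∈ A \ E, 2 * (S.filter fun h => ¬ y * h ∈ A).card := by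
        refine Finset.sum_le_sum fun y hy => ?_
        have h2 := mt (hE y).2 (Finset.mem_sdiff.1 hy).2
        have h3 := Finset.card_filter_add_card_filter_not (s := S) (fun h => y * h ∈ A)
        omega
      _ = 2 * ∑ h ∈ S, ((A \ E).filter fun y => ¬ y * h ∈ A).card := by
        rw [← Finset.mul_sum]
        congr 1
        exact Finset.sum_card_bipartiteAbove_eq_sum_card_bipartiteBelow fun y h => ¬ y * h ∈ A
      _ ≤ _ := by
        gcongr with h hh
        refine (Finset.card_le_card fun y hy => ?_).trans (card_sdiff_rightShift_le A h)
        simp only [Finset.mem_filter, Finset.mem_sdiff, mem_rightShift] at hy ⊢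
        exact ⟨hy.1.1, hy.2⟩
  have h2 : (E \ A).card * S.card ≤ 2 * ∑ h ∈ S, shiftDist A h := by
    calc (E \ A).card * S.card = ∑ _y ∈ E \ A, S.card := by simp
      _ ≤ ∑ y ∈ E \ A, 2 * (S.filter fun h => y * h ∈ A).card := by
        exact Finset.sum_le_sum fun y hy => ((hE y).1 (Finset.mem_sdiff.1 hy).1).le
      _ = 2 * ∑ h ∈ S, ((E \ A).filter fun y => y * h ∈ A).card := by
        rw [← Finset.mul_sum]
        congr 1
        exact Finset.sum_card_bipartiteAbove_eq_sum_card_bipartiteBelow fun y h => y * h ∈ A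
      _ ≤ _ := by
        gcongr with h hh
        refine Finset.card_le_card fun y hy => ?_
        simp only [Finset.mem_filter, Finset.mem_sdiff, Finset.mem_symmDiff, mem_rightShift] at hy ⊢
        exact Or.inl ⟨hy.2, hy.1.2⟩
  have h3 : (A ∆ E).card ≤ (A \ E).card + (E \ A).card := Finset.card_union_le _ _
  have h4 : ((A ∆ E).card : ℝ) * S.card ≤ 4 * (∑ h ∈ S, shiftDist A h : ℕ) := by
    have : (A ∆ E).card * S.card ≤ 4 * ∑ h ∈ S, shiftDist A h := by nlinarith
    exact_mod_cast this
  refine le_of_mul_le_mul_right (h4.trans ?_) hSpos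
  linarith

/-- A finite set can be covered by left cosets of a finite subgroup `H`, and it is close to a union
of some of these cosets if it is almost invariant under `H`. -/
theorem exists_coset_approximation {A S : Finset G} {H : Subgroup G} (hS : (S : Set G) = H)
    {r : ℝ} (hr : ∀ h ∈ S, (shiftDist A h : ℝ) ≤ r) :
    ∃ C ⊆ A, A ⊆ C * S ∧ C.card * S.card = (A * S).card ∧
      ∃ D ⊆ C, ((A ∆ (D * S)).card : ℝ) ≤ 4 * r := by
  have hmem : ∀ h, h ∈ S ↔ h ∈ H := fun h => by
    rw [← Finset.mem_coe, hS, SetLike.mem_coe]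
  obtain ⟨C, hCA, hC⟩ := Set.exists_subset_bijOn (A : Set G) (fun a => (a : G ⧸ H))
  lift C to Finset G using A.finite_toSet.subset hCA
  have hCA : C ⊆ A := by exact_mod_cast hCA
  have hcov : ∀ a ∈ A, ∃ c ∈ C, c⁻¹ * a ∈ H := by
    intro a ha
    obtain ⟨c, hc, hca⟩ := hC.surjOn ⟨a, ha, rfl⟩
    exact ⟨c, hc, QuotientGroup.eq.1 hca⟩
  have hAC : A ⊆ C * S := by
    intro a ha
    obtain ⟨c, hc, hca⟩ := hcov a ha
    exact Finset.mem_mul.2 ⟨c, hc, _, (hmem _).2 hca, by group⟩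
  -- C is a transversal of the cosets meeting A; D keeps those of which A occupies more than half.
  refine ⟨C, hCA, hAC, ?_, C.filter fun y => S.card < 2 * (S.filter fun h => y * h ∈ A).card,
    Finset.filter_subset _ _, ?_⟩
  · have h1 : A * S = C * S := by
      refine Finset.Subset.antisymm (fun x hx => ?_) (Finset.mul_subset_mul_right hCA)
      obtain ⟨a, ha, h, hh, rfl⟩ := Finset.mem_mul.1 hx
      obtain ⟨c, hc, hca⟩ := hcov a ha
      exact Finset.mem_mul.2 ⟨c, hc, _, (hmem _).2 (H.mul_mem hca ((hmem _).1 hh)), by group⟩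
    rw [h1, eq_comm, Finset.card_mul_iff]
    rintro ⟨c₁, s₁⟩ ⟨hc₁, hs₁⟩ ⟨c₂, s₂⟩ ⟨hc₂, hs₂⟩ (h : c₁ * s₁ = c₂ * s₂)
    have hs₁ := (hmem _).1 hs₁
    have hs₂ := (hmem _).1 hs₂
    have : c₁ = c₂ := by
      refine hC.injOn hc₁ hc₂ (QuotientGroup.eq.2 ?_)
      have : c₁⁻¹ * c₂ = s₁ * s₂⁻¹ := by
        rw [inv_mul_eq_iff_eq_mul, ← mul_assoc, h, mul_inv_cancel_right]
      rw [this]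
      exact H.mul_mem hs₁ (H.inv_mem hs₂)
    subst this
    simpa using h
  · refine card_symmDiff_le_of_almost_invariant ⟨1, (hmem 1).2 H.one_mem⟩ hr fun y => ?_
    constructor
    · intro hy
      obtain ⟨d, hd, s, hs, rfl⟩ := Finset.mem_mul.1 hy
      rw [card_filter_mul_mem_of_subgroup A S H hS d ((hmem s).1 hs)]
      exact (Finset.mem_filter.1 hd).2
    · intro hy
      obtain ⟨s, hs⟩ : (S.filter fun h => y * h ∈ A).Nonempty := by
        rw [← Finset.card_pos]; omega
      rw [Finset.mem_filter] at hs
      obtain ⟨c, hc, hcs⟩ := hcov _ hs.2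
      have hs' := (hmem s).1 hs.1
      have hcy : c⁻¹ * y ∈ H := by
        have := H.mul_mem hcs (H.inv_mem hs')
        simpa [mul_assoc] using this
      refine Finset.mem_mul.2 ⟨c, Finset.mem_filter.2 ⟨hc, ?_⟩, _, (hmem _).2 hcy, by group⟩
      rw [← card_filter_mul_mem_of_subgroup A S H hS c hcy, mul_inv_cancel_left]
      exact hy

end Cosets

/-! ### The recursive choice of scales. -/

section Scales

/-- The bound for the number of cosets at the `m`-th scale, as a function of `q = c / ε`. -/
noncomputable def scaleBound (k : ℕ) (q : ℝ) : ℕ → ℝ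
  | 0 => q
  | m + 1 => 64 * q * (k * (4 * k * scaleBound k q m) ^ k) ^ 2

/-- Each recursion step takes a fixed power and multiplies by a multiple of q, so monomials stay
monomials. This is the source of the polynomial bound in c/ε. -/
theorem exists_scaleBound_eq (k m : ℕ) : ∃ (K : ℝ) (N : ℕ), ∀ q, scaleBound k q m = K * q ^ N := by
  induction m with
  | zero => exact ⟨1, 1, fun q => by simp [scaleBound]⟩
  | succ m ih =>
    obtain ⟨K, N, h⟩ := ih
    refine ⟨64 * (k * (4 * k * K) ^ k) ^ 2, 1 + N * k * 2, fun q => ?_⟩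
    rw [scaleBound, h, pow_add, pow_mul, pow_mul]
    ring

theorem le_sq_mul_pow {k : ℕ} (hk : k ≠ 0) {u : ℝ} (hu : 1 ≤ u) :
    u ≤ (k * (4 * k * u) ^ k) ^ 2 := by
  have hk1 : (1 : ℝ) ≤ k := by exact_mod_cast Nat.one_le_iff_ne_zero.2 hk
  have h1 : u ≤ 4 * k * u := by nlinarith
  have h2 : 4 * k * u ≤ (4 * k * u) ^ k := le_self_pow₀ (by linarith) hk
  have h3 : u ≤ k * (4 * k * u) ^ k := by nlinarith
  nlinarith

theorem one_le_scaleBound {k : ℕ} (hk : k ≠ 0) {q : ℝ} (hq : 1 ≤ q) (m : ℕ) :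
    1 ≤ scaleBound k q m := by
  induction m with
  | zero => exact hq
  | succ m ih =>
    have := le_sq_mul_pow hk ih
    rw [scaleBound]
    nlinarith

theorem scaleBound_mono {k : ℕ} (hk : k ≠ 0) {q : ℝ} (hq : 1 ≤ q) : Monotone (scaleBound k q) := by
  refine monotone_nat_of_le_succ fun m => ?_
  have h1 := one_le_scaleBound hk hq m
  have := le_sq_mul_pow hk h1
  rw [scaleBound]
  nlinarith

end Scales

/-! ### The gap, the subgroup and the structure theorem. -/

/-- If there is no tree of height `n`, then at one of the first `n` scales no element moves `A` by an
intermediate amount. -/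
theorem exists_scale_of_not_hasTree {G : Type*} [Group G] [DecidableEq G] {n : ℕ} {A : Finset G}
    (hn : ∀ V : Set G, ¬ HasTree (fun x y : G => x * y ∈ (A : Set G)) n Set.univ V) (s r : ℕ → ℝ)
    (hs : ∀ m, 0 ≤ s m) (hsr : ∀ m, 8 * s (m + 1) ≤ r m) :
    ∃ m < n, ∀ g, (shiftDist A g : ℝ) ≤ s m → (shiftDist A g : ℝ) ≤ r m := by
  by_contra! h
  have h' : ∀ m, ∃ g, m < n → (shiftDist A g : ℝ) ≤ s m ∧ r m < shiftDist A g := by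
    intro m
    by_cases hm : m < n
    · obtain ⟨g, hg⟩ := h m hm
      exact ⟨g, fun _ => hg⟩
    -- A default value; scales from n on play no role.
    · exact ⟨1, fun h => absurd h hm⟩
  choose g hg using h'
  obtain ⟨P, -, -, -, hP⟩ := exists_hasTree_of_scales A s r g n hs hsr hg n 0 (by omega)
  exact hn _ (hP 1)

/-- The structure theorem for finite stable sets of small tripling, in terms of finsets. -/
theorem IsKStable.exists_subgroup_approximation {G : Type*} [Group G] [DecidableEq G] {k n : ℕ}
    {A : Finset G} (hA : IsKStable k (A : Set G)) (hne : A.Nonempty)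
    (hn : ∀ V : Set G, ¬ HasTree (fun x y : G => x * y ∈ (A : Set G)) n Set.univ V) {c ε : ℝ}
    (hc : ((A * A⁻¹ * A).card : ℝ) ≤ c * A.card) (hε0 : 0 < ε) (hε1 : ε ≤ 1) :
    ∃ (H : Subgroup G) (S : Finset G), (S : Set G) = H ∧ S ⊆ A⁻¹ * A ∧ ∃ C ⊆ A, A ⊆ C * S ∧
      (C.card : ℝ) ≤ scaleBound k (c * ε⁻¹) n ∧
      ∃ D ⊆ C, ((A ∆ (D * S)).card : ℝ) < ε * S.card := by
  have hk0 : k ≠ 0 := by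
    rintro rfl
    exact hA ⟨Fin.elim0, Fin.elim0, fun i => i.elim0⟩
  have hApos : (0 : ℝ) < A.card := by exact_mod_cast hne.card_pos
  have hc1 : 1 ≤ c := by
    obtain ⟨a, ha⟩ := hne
    have : (A.card : ℝ) ≤ (A * A⁻¹ * A).card := by
      exact_mod_cast Finset.card_le_card_mul_left
        ⟨a * a⁻¹, Finset.mul_mem_mul ha (Finset.inv_mem_inv ha)⟩
    nlinarith
  have hcq : c ≤ c * ε⁻¹ := le_mul_of_one_le_right (by linarith) ((one_le_inv₀ hε0).2 hε1)
  set q := c * ε⁻¹ with hq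
  have hq1 : 1 ≤ q := hc1.trans hcq
  set u := scaleBound k q with hu
  have hu1 : ∀ m, 1 ≤ u m := one_le_scaleBound hk0 hq1
  have humono : Monotone u := scaleBound_mono hk0 hq1
  set L : ℕ → ℝ := fun m => (k * (4 * k * u m) ^ k) ^ 2 with hL
  have huL : ∀ m, u m ≤ L m := fun m => le_sq_mul_pow hk0 (hu1 m)
  have hLpos : ∀ m, 0 < L m := fun m => by linarith [huL m, hu1 m]
  have husucc : ∀ m, u (m + 1) = 64 * q * L m := fun m => rfl
  -- Packing with δ = c / u m gives |A| ≤ L m · |H|, so this `r m` makes 4r ≤ ε|H|/2. The factor 64q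
  -- in the recursion makes `8 * s (m + 1)` equal to `r m`.
  set s : ℕ → ℝ := fun m => c / u m * A.card with hs
  set r : ℕ → ℝ := fun m => ε / (8 * L m) * A.card with hr
  have hs0 : ∀ m, 0 ≤ s m := fun m => by
    have := hu1 m
    simp only [hs]
    positivity
  have hsr : ∀ m, 8 * s (m + 1) ≤ r m := fun m => by
    have := hLpos m
    simp only [hs, hr, husucc, hq]
    apply le_of_eq
    field_simp
    norm_num
  obtain ⟨m, hmn, hm⟩ := exists_scale_of_not_hasTree hn s r hs0 hsr
  have hLm := hLpos m
  have hum := hu1 m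
  have hr0 : 0 ≤ r m := by simp only [hr]; positivity
  have hrs : 2 * r m ≤ s m := by
    simp only [hs, hr]
    rw [← mul_assoc]
    gcongr
    rw [← mul_div_assoc, div_le_div_iff₀ (by positivity) (by positivity)]
    have h1 : ε * u m ≤ c * L m := mul_le_mul (hε1.trans hc1) (huL m) (by linarith) (by linarith)
    nlinarith
  set H := shiftStabilizer A (s m) (r m) hr0 hrs hm with hH
  have hsA : s m ≤ A.card := by
    have : c ≤ u m := hcq.trans (humono (Nat.zero_le m))
    have h1 : c / u m ≤ 1 := by rw [div_le_one (by linarith)]; exact this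
    simp only [hs]
    nlinarith
  set S := (A⁻¹ * A).filter fun g => (shiftDist A g : ℝ) ≤ s m with hS
  have hSH : (S : Set G) = H := by
    ext g
    simp only [hS, Finset.coe_filter, Set.mem_ofPred_eq]
    refine ⟨fun h => h.2, fun h => ⟨mem_inv_mul_of_shiftDist_le hne ?_, h⟩⟩
    exact_mod_cast (show (shiftDist A g : ℝ) ≤ s m from h).trans hsA
  have hScard : (A.card : ℝ) ≤ L m * S.card := by
    have h := hA.card_le_mul_card_almost_invariant hne hc (δ := c / u m) (by positivity) (by
      rw [div_le_one (by linarith)]; exact hcq.trans (humono (Nat.zero_le m)))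
    rwa [div_div_cancel₀ (by linarith)] at h
  have hSpos : (0 : ℝ) < S.card := by
    by_contra! h
    nlinarith
  obtain ⟨C, hCA, hAC, hC, D, hDC, hD⟩ := exists_coset_approximation hSH (r := r m)
    fun h hh => hm h (Finset.mem_filter.1 hh).2
  have hSA : S ⊆ A⁻¹ * A := Finset.filter_subset _ _
  refine ⟨H, S, hSH, hSA, C, hCA, hAC, ?_, D, hDC, hD.trans_lt ?_⟩
  · have h1 : (C.card : ℝ) * S.card ≤ c * L m * S.card := by
      calc (C.card : ℝ) * S.card ≤ (A * A⁻¹ * A).card := by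
            have : (A * S).card ≤ (A * A⁻¹ * A).card := by
              rw [mul_assoc]
              exact Finset.card_le_card (Finset.mul_subset_mul_left hSA)
            rw [← hC] at this
            exact_mod_cast this
        _ ≤ c * A.card := hc
        _ ≤ c * (L m * S.card) := by gcongr
        _ = _ := by ring
    calc (C.card : ℝ) ≤ c * L m := le_of_mul_le_mul_right h1 hSpos
      _ ≤ q * L m := by gcongr
      _ ≤ u (m + 1) := by
        rw [husucc]
        nlinarith [mul_pos (show 0 < q by linarith) hLm]
      _ ≤ u n := humono hmn
  · calc 4 * r m = ε / (2 * L m) * A.card := by simp only [hr]; field_simp; norm_num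
      _ ≤ ε / (2 * L m) * (L m * S.card) := by gcongr
      _ = ε * S.card / 2 := by field_simp
      _ < ε * S.card := by linarith [mul_pos hε0 hSpos]

theorem theorem1p6 (k : ℕ) :
    ∃ (K : ℝ) (N : ℕ), ∀ (G : Type*) [Group G] (A : Set G) (c ε : ℝ),
      A.Finite → A.Nonempty → IsKStable k A →
      ((A * A⁻¹ * A).ncard : ℝ) ≤ c * (A.ncard : ℝ) →
      0 < ε → ε ≤ 1 / 2 →
      ∃ H : Subgroup G, (H : Set G) ⊆ A⁻¹ * A ∧
        ∃ C : Set G, C ⊆ A ∧ (C.ncard : ℝ) ≤ K * (c * ε⁻¹) ^ N ∧ A ⊆ C * (H : Set G) ∧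
          ∃ D : Set G, D ⊆ C ∧
            ((A ∆ (D * (H : Set G))).ncard : ℝ) < ε * ((H : Set G).ncard : ℝ) := by
  obtain ⟨n, hn⟩ := IsKStable.exists_height_not_hasTree k
  obtain ⟨K, N, hKN⟩ := exists_scaleBound_eq k n
  refine ⟨K, N, fun G _ A c ε hfin hne hA hc hε0 hε1 => ?_⟩
  classical
  lift A to Finset G using hfin
  rw [← Finset.coe_inv, ← Finset.coe_mul, ← Finset.coe_mul, Set.ncard_coe_finset,
    Set.ncard_coe_finset] at hc
  obtain ⟨H, S, hSH, hSA, C, hCA, hAC, hC, D, hDC, hD⟩ :=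
    hA.exists_subgroup_approximation (by exact_mod_cast hne) (hn hA) hc hε0 (by linarith)
  refine ⟨H, ?_, C, by exact_mod_cast hCA, ?_, ?_, D, by exact_mod_cast hDC, ?_⟩
  · rw [← hSH]; exact_mod_cast hSA
  · rw [Set.ncard_coe_finset, ← hKN]; exact hC
  · rw [← hSH]; exact_mod_cast hAC
  · rw [← hSH, ← Finset.coe_mul, ← Finset.coe_symmDiff, Set.ncard_coe_finset,
      Set.ncard_coe_finset]
    exact hD
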